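/- Let $d\ge 2$ and let $\Omega\subset\mathbb{R}^d$ be a bounded, connected, nonempty open set. Let $H^1(\Omega)$ be the space of real-valued functions $u\in L^2(\Omega)$ with weak partial derivatives $\partial_j u\in L^2(\Omega)$, with norm $\|u\|_{H^1(\Omega)}=\big(\|u\|_{L^2(\Omega)}^2+\sum_{j=1}^d\|\partial_j u\|_{L^2(\Omega)}^2\big)^{1/2}$, and let $H^1_0(\Omega)$ be the closure of $C_c^\infty(\Omega)$ in $H^1(\Omega)$. Let $C_0(\Omega)$ be the space of continuous $v\colon\Omega\to\mathbb{R}$ such that $\lim_{x\to z}v(x)=0$ for every $z\in\partial\Omega$. For $v$ continuous and bounded on $\Omega$, write $\Delta v\in H^{-1}(\Omega)$ if there is $M\ge 0$ such that $$\Big|\int_\Omega v\,\Delta w\,dx\Big|\le M\|w\|_{H^1(\Omega)}\qquad\text{for all } w\in C_c^\infty(\Omega).$$ (a) If $v\in C_0(\Omega)$ and $\Delta v\in H^{-1}(\Omega)$, then $v\in H^1_0(\Omega)$. (b) Consequently, the variational solution $u_\varphi$ of the Dirichlet problem does not depend on the chosen extension: let $\varphi\in C(\partial\Omega)$ and let $\Phi_1,\Phi_2\in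 C(\overline\Omega)$ satisfy $\Phi_i|_{\partial\Omega}=\varphi$ and $\Delta\Phi_i\in H^{-1}(\Omega)$ for $i=1,2$. If, for $i=1,2$, the function $u_i$ is harmonic on $\Omega$ and $u_i=\Phi_i-v_i$ almost everywhere on $\Omega$, where $v_i\in H^1_0(\Omega)$ satisfies $$\int_\Omega\Phi_i\,\Delta w\,dx=-\int_\Omega\nabla v_i\cdot\nabla w\,dx\qquad\text{for all } w\in C_c^\infty(\Omega),$$ then $u_1=u_2$ on $\Omega$. -/

import Mathlib

open MeasureTheory Filter Set
open scoped Topology ContDiff Gradient Laplacian InnerProductSpace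

noncomputable section

/-- The Euclidean space `ℝᵈ`. -/
abbrev Eu (d : ℕ) : Type := EuclideanSpace ℝ (Fin d)

/-- `w ∈ C_c^∞(Ω)`, with `w` extended by zero to the whole space. -/
structure IsTestFunction {d : ℕ} (Ω : Set (Eu d)) (w : Eu d → ℝ) : Prop where
  smooth : ContDiff ℝ ∞ w
  compact : HasCompactSupport w
  support_subset : tsupport w ⊆ Ω

/-- `v ∈ C_0(Ω)` for a bounded open set `Ω`: `v` is continuous on `Ω` and vanishes at the boundary.
Only the values of `v` on `Ω` matter. -/
structure IsC0 {d : ℕ} (Ω : Set (Eu d)) (v : Eu d → ℝ) : Prop where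
  continuousOn : ContinuousOn v Ω
  tendsto_zero : ∀ z ∈ frontier Ω, Tendsto v (𝓝[Ω] z) (𝓝 0)

/-- `u ∈ H¹(Ω)` with weak gradient `g`: both are square integrable over `Ω`, and
`∫_Ω u ∇w = - ∫_Ω w g` (an identity of vectors, that is, one identity for each `∂_j`)
for all test functions `w`. -/
structure HasH1Gradient {d : ℕ} (Ω : Set (Eu d)) (u : Eu d → ℝ) (g : Eu d → Eu d) : Prop where
  memLp : MemLp u 2 (volume.restrict Ω)
  memLp_gradient : MemLp g 2 (volume.restrict Ω)
  integral_eq : ∀ w : Eu d → ℝ, IsTestFunction Ω w →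
    ∫ x in Ω, u x • ∇ w x = - ∫ x in Ω, w x • g x

/-- The norm of `H¹(Ω)`, evaluated at a function `u` with (weak or classical) gradient `g`. -/
def h1Norm {d : ℕ} (Ω : Set (Eu d)) (u : Eu d → ℝ) (g : Eu d → Eu d) : ℝ :=
  √((∫ x in Ω, u x ^ 2) + ∫ x in Ω, ‖g x‖ ^ 2)

/-- `u ∈ H¹₀(Ω)` with weak gradient `g`: `u ∈ H¹(Ω)` lies in the closure of `C_c^∞(Ω)` with respect
to the norm of `H¹(Ω)`. -/
structure HasH10Gradient {d : ℕ} (Ω : Set (Eu d)) (u : Eu d → ℝ) (g : Eu d → Eu d) : Prop where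
  hasH1Gradient : HasH1Gradient Ω u g
  mem_closure : ∀ ε : ℝ, 0 < ε → ∃ w : Eu d → ℝ, IsTestFunction Ω w ∧
    h1Norm Ω (fun x => u x - w x) (fun x => g x - ∇ w x) < ε

/-- `u ∈ H¹₀(Ω)`. -/
def MemH10 {d : ℕ} (Ω : Set (Eu d)) (u : Eu d → ℝ) : Prop :=
  ∃ g : Eu d → Eu d, HasH10Gradient Ω u g

/-- `Δv ∈ H⁻¹(Ω)`: the distributional Laplacian `w ↦ ∫_Ω v Δw` is bounded on `C_c^∞(Ω)` for the norm
of `H¹(Ω)`, that is, it extends to a continuous linear functional on `H¹₀(Ω)`. -/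
def LaplacianMemHNegOne {d : ℕ} (Ω : Set (Eu d)) (v : Eu d → ℝ) : Prop :=
  ∃ M : ℝ, 0 ≤ M ∧ ∀ w : Eu d → ℝ, IsTestFunction Ω w →
    |∫ x in Ω, v x * (Δ w) x| ≤ M * h1Norm Ω w (∇ w)

/-- `Φ ∈ C(Ω̄)` extends `φ`, a function on the boundary `∂Ω`, and `ΔΦ ∈ H⁻¹(Ω)`. -/
structure IsAdmissibleExtension {d : ℕ} (Ω : Set (Eu d)) (φ : frontier Ω → ℝ) (Φ : Eu d → ℝ) :
    Prop where
  continuousOn : ContinuousOn Φ (closure Ω)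
  extends_boundary : ∀ z : frontier Ω, Φ z = φ z
  laplacian_mem : LaplacianMemHNegOne Ω Φ

/-- `u` is the variational solution constructed from the extension `Φ`: `u` is harmonic on `Ω` and
`u = Φ - v` almost everywhere, where `v ∈ H¹₀(Ω)` satisfies
`∫_Ω Φ Δw = - ∫_Ω ∇v ∇w` for all test functions `w`. -/
def IsVariationalSolutionFrom {d : ℕ} (Ω : Set (Eu d)) (Φ u : Eu d → ℝ) : Prop :=
  InnerProductSpace.HarmonicOnNhd u Ω ∧
  ∃ (v : Eu d → ℝ) (g : Eu d → Eu d), HasH10Gradient Ω v g ∧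
    (∀ w : Eu d → ℝ, IsTestFunction Ω w →
      ∫ x in Ω, Φ x * (Δ w) x = - ∫ x in Ω, ⟪g x, ∇ w x⟫_ℝ) ∧
    ∀ᵐ x ∂(volume.restrict Ω), u x = Φ x - v x

end

/-! For (a), extend `v` by zero to a continuous, compactly supported `V`, mollify it to a smooth `u`
uniformly close to `V`, and set `w = f ∘ u`, where `f` vanishes near zero, `0 ≤ f' ≤ 1` and `f` is
uniformly close to the identity. Then `w` is supported where `|V|` is bounded below, a compact
subset of `Ω`, so it is a test function. Since `f' ^ 2 ≤ f'`, `∫ |∇w|² ≤ ∫ ∇u · ∇w = -∫ u Δw`. The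
mollification can be moved onto `w` as an average of translates, so the last term is at most `M ‖w‖`
in the `H¹` norm (`abs_integral_convolution_mul_laplacian_le`). Absorbing the gradient bounds `w` in
`H¹` (`integral_gradient_truncation_sq_le`), while `w` tends uniformly to `v`. A bounded sequence in
a closed subspace of a Hilbert space cannot lose its limit (`exists_mem_map_eq_of_bounded_approx`),
so `v` lies in `H¹₀`.

For (b), (a) puts `Φ₁ - Φ₂` in `H¹₀`. Hence `(Φ₁ - Φ₂) - (v₁ - v₂)` is a weakly harmonic element of
`H¹₀`, which vanishes by Poincaré's inequality, and it equals `u₁ - u₂` almost everywhere. -/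

/-! ### Bounded approximation in Hilbert spaces -/

/-- If a bounded family in a closed subspace `S` of a Hilbert space has images under a continuous
linear map `L` which approximate `v`, then `v` is itself the image of an element of `S`. -/
lemma exists_mem_map_eq_of_bounded_approx {H F : Type*} [NormedAddCommGroup H]
    [InnerProductSpace ℝ H] [CompleteSpace H] [NormedAddCommGroup F] [NormedSpace ℝ F]
    (S : Submodule ℝ H) (hS : IsClosed (S : Set H)) (L : H →L[ℝ] F) (v : F) (C : ℝ)
    (h : ∀ ε : ℝ, 0 < ε → ∃ x ∈ S, ‖x‖ ≤ C ∧ ‖L x - v‖ ≤ ε) :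
    ∃ x ∈ S, L x = v := by
  -- The points of least norm in these nested closed convex sets converge in norm, which replaces an
  -- argument by weak compactness.
  let K : ℕ → Set H := fun n => S ∩ L ⁻¹' Metric.closedBall v (1 / (n + 1 : ℝ))
  have hKne : ∀ n, ∃ x ∈ K n, ‖x‖ ≤ C := fun n => by
    obtain ⟨x, hxS, hxC, hxv⟩ := h (1 / (n + 1 : ℝ)) (by positivity)
    exact ⟨x, ⟨hxS, by simpa [dist_eq_norm] using hxv⟩, hxC⟩
  have hKcl : ∀ n, IsClosed (K n) := fun n =>
    hS.inter (Metric.isClosed_closedBall.preimage L.continuous)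
  have hKcv : ∀ n, Convex ℝ (K n) := fun n =>
    S.convex.inter ((convex_closedBall v _).linear_preimage L.toLinearMap)
  have hKanti : ∀ m n, m ≤ n → K n ⊆ K m := fun m n hmn x hx =>
    ⟨hx.1, Metric.closedBall_subset_closedBall (Nat.one_div_le_one_div hmn) hx.2⟩
  have hmin : ∀ n, ∃ y ∈ K n, ∀ z ∈ K n, ‖y‖ ≤ ‖z‖ := fun n => by
    obtain ⟨x, hx, -⟩ := hKne n
    obtain ⟨y, hy, hy'⟩ := exists_norm_eq_iInf_of_complete_convex ⟨x, hx⟩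
      (hKcl n).isComplete (hKcv n) 0
    refine ⟨y, hy, fun z hz => ?_⟩
    have : ⨅ w : K n, ‖0 - (w : H)‖ ≤ ‖0 - z‖ :=
      ciInf_le (f := fun w : K n => ‖0 - (w : H)‖)
        ⟨0, Set.forall_mem_range.2 fun _ => norm_nonneg _⟩ ⟨z, hz⟩
    rw [← hy'] at this
    simpa only [zero_sub, norm_neg] using this
  choose y hyK hymin using hmin
  have hbound : ∀ n, ‖y n‖ ≤ C := fun n => by
    obtain ⟨x, hx, hxC⟩ := hKne n
    exact (hymin n x hx).trans hxC
  have hmono : Monotone fun n => ‖y n‖ ^ 2 := fun m n hmn => by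
    have := hymin m _ (hKanti m n hmn (hyK n))
    dsimp only
    gcongr
  have hcauchy0 : CauchySeq fun n => ‖y n‖ ^ 2 := by
    refine (tendsto_atTop_ciSup hmono ⟨C ^ 2, ?_⟩).cauchySeq
    rintro _ ⟨n, rfl⟩
    have := hbound n
    dsimp only
    gcongr
  -- The midpoint of `y m` and `y n` lies in `K m`, so its norm is at least `‖y m‖`; the
  -- parallelogram law does the rest.
  have hpar : ∀ m n, m ≤ n → ‖y n - y m‖ ^ 2 ≤ 2 * (‖y n‖ ^ 2 - ‖y m‖ ^ 2) := fun m n hmn => by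
    have hmid : (1 / 2 : ℝ) • y n + (1 / 2 : ℝ) • y m ∈ K m :=
      hKcv m (hKanti m n hmn (hyK n)) (hyK m) (by norm_num) (by norm_num) (by norm_num)
    have h1 := hymin m _ hmid
    rw [← smul_add, norm_smul] at h1
    norm_num at h1
    have h2 := parallelogram_law_with_norm ℝ (y n) (y m)
    have h3 : (2 * ‖y m‖) ^ 2 ≤ ‖y n + y m‖ ^ 2 := by
      have := norm_nonneg (y m)
      gcongr
      linarith
    nlinarith
  have hcauchy : CauchySeq y := by
    rw [Metric.cauchySeq_iff'] at hcauchy0 ⊢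
    intro ε hε
    obtain ⟨N, hN⟩ := hcauchy0 (ε ^ 2 / 2) (by positivity)
    refine ⟨N, fun n hn => ?_⟩
    have h1 := hN n hn
    rw [Real.dist_eq] at h1
    have h2 := hpar N n hn
    have h3 := le_abs_self (‖y n‖ ^ 2 - ‖y N‖ ^ 2)
    rw [dist_eq_norm]
    exact lt_of_pow_lt_pow_left₀ 2 hε.le (by linarith)
  obtain ⟨x, hx⟩ := cauchySeq_tendsto_of_complete hcauchy
  refine ⟨x, hS.mem_of_tendsto hx (Eventually.of_forall fun n => (hyK n).1), ?_⟩
  refine tendsto_nhds_unique ((L.continuous.tendsto x).comp hx) ?_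
  refine tendsto_iff_dist_tendsto_zero.2 (squeeze_zero (fun _ => dist_nonneg) (fun n => ?_)
    (tendsto_one_div_add_atTop_nhds_zero_nat (𝕜 := ℝ)))
  exact (hyK n).2

/-! ### Calculus of test functions and Poincaré's inequality -/

section Gradient

variable {d : ℕ} {Ω : Set (Eu d)} {u w : Eu d → ℝ}

lemma gradient_apply_eq_fderiv (w : Eu d → ℝ) (x : Eu d) (i : Fin d) :
    (∇ w x) i = fderiv ℝ w x (EuclideanSpace.single i 1) := by
  rw [← inner_gradient_left (𝕜 := ℝ) (F := Eu d), EuclideanSpace.inner_single_right]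
  simp

lemma ContDiff.gradient (hw : ContDiff ℝ ∞ w) : ContDiff ℝ ∞ (∇ w) :=
  (InnerProductSpace.toDual ℝ (Eu d)).symm.contDiff.comp (hw.fderiv_right (by simp))

lemma support_gradient_subset (w : Eu d → ℝ) : Function.support (∇ w) ⊆ tsupport w := by
  refine Subset.trans (fun x hx => ?_) (support_fderiv_subset ℝ)
  simpa [gradient] using hx

lemma HasCompactSupport.gradient (hw : HasCompactSupport w) : HasCompactSupport (∇ w) :=
  HasCompactSupport.intro hw fun _ hx => by
    by_contra h
    exact hx (support_gradient_subset w h)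

lemma gradient_add' (hu : Differentiable ℝ u) (hw : Differentiable ℝ w) :
    (∇ fun x => u x + w x) = fun x => ∇ u x + ∇ w x := by
  ext1 x
  simp [_root_.gradient, fderiv_fun_add (hu x) (hw x)]

lemma gradient_const_mul (c : ℝ) (hw : Differentiable ℝ w) :
    (∇ fun x => c * w x) = fun x => c • ∇ w x := by
  ext1 x
  simp [_root_.gradient, fderiv_const_mul (hw x)]

lemma laplacian_eq_sum_fderiv_fderiv (hw : ContDiff ℝ ∞ w) (x : Eu d) :
    (Δ w) x = ∑ i, fderiv ℝ (fun y => fderiv ℝ w y (EuclideanSpace.single i 1)) x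
      (EuclideanSpace.single i 1) := by
  rw [InnerProductSpace.laplacian_eq_iteratedFDeriv_orthonormalBasis w
    (EuclideanSpace.basisFun (Fin d) ℝ)]
  refine Finset.sum_congr rfl fun i _ => ?_
  rw [iteratedFDeriv_two_apply]
  have : DifferentiableAt ℝ (fderiv ℝ w) x :=
    ((hw.fderiv_right (m := ∞) (by simp)).differentiable (by simp)) x
  rw [fderiv_clm_apply this (differentiableAt_const _)]
  simp

lemma ContDiff.continuous_laplacian (hw : ContDiff ℝ ∞ w) : Continuous (Δ w) := by
  have h (i : Fin d) : Continuous fun x => fderiv ℝ (fun y => fderiv ℝ w y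
      (EuclideanSpace.single i 1)) x (EuclideanSpace.single i 1) := by
    have h1 : ContDiff ℝ ∞ (fun y => fderiv ℝ w y (EuclideanSpace.single i 1)) :=
      (hw.fderiv_right (m := ∞) (by simp)).clm_apply contDiff_const
    exact ((h1.fderiv_right (m := ∞) (by simp)).clm_apply contDiff_const).continuous
  rw [funext (laplacian_eq_sum_fderiv_fderiv hw)]
  exact continuous_finsetSum _ fun i _ => h i

lemma support_laplacian_subset (w : Eu d → ℝ) : Function.support (Δ w) ⊆ tsupport w := by
  intro x hx
  by_contra h
  refine hx ?_
  have h0 : w =ᶠ[𝓝 x] fun _ => (0 : ℝ) := by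
    filter_upwards [(isClosed_tsupport w).isOpen_compl.mem_nhds h] with y hy
    exact image_eq_zero_of_notMem_tsupport hy
  rw [(InnerProductSpace.laplacian_congr_nhds h0).eq_of_nhds]
  simp

lemma HasCompactSupport.laplacian (hw : HasCompactSupport w) : HasCompactSupport (Δ w) :=
  HasCompactSupport.intro hw fun _ hx => by
    by_contra h
    exact hx (support_laplacian_subset w h)

namespace IsTestFunction

lemma memLp (hw : IsTestFunction Ω w) (μ : Measure (Eu d)) [IsLocallyFiniteMeasure μ] :
    MemLp w 2 μ :=
  hw.smooth.continuous.memLp_of_hasCompactSupport hw.compact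

lemma memLp_gradient (hw : IsTestFunction Ω w) (μ : Measure (Eu d)) [IsLocallyFiniteMeasure μ] :
    MemLp (∇ w) 2 μ :=
  hw.smooth.gradient.continuous.memLp_of_hasCompactSupport hw.compact.gradient

lemma differentiable (hw : IsTestFunction Ω w) : Differentiable ℝ w :=
  hw.smooth.differentiable (by simp)

lemma eq_zero_of_notMem (hw : IsTestFunction Ω w) {x : Eu d} (hx : x ∉ Ω) : w x = 0 :=
  image_eq_zero_of_notMem_tsupport fun h => hx (hw.support_subset h)

lemma gradient_eq_zero_of_notMem (hw : IsTestFunction Ω w) {x : Eu d} (hx : x ∉ Ω) :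
    ∇ w x = 0 := by
  by_contra h
  exact hx (hw.support_subset (support_gradient_subset w h))

lemma laplacian_eq_zero_of_notMem (hw : IsTestFunction Ω w) {x : Eu d} (hx : x ∉ Ω) :
    (Δ w) x = 0 := by
  by_contra h
  exact hx (hw.support_subset (support_laplacian_subset w h))

lemma zero (Ω : Set (Eu d)) : IsTestFunction Ω (fun _ => (0 : ℝ)) :=
  ⟨contDiff_const, HasCompactSupport.zero, by
    rw [show tsupport (fun _ : Eu d => (0 : ℝ)) = ∅ from tsupport_eq_empty_iff.2 rfl]; exact empty_subset _⟩

lemma add (hu : IsTestFunction Ω u) (hw : IsTestFunction Ω w) :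
    IsTestFunction Ω (fun x => u x + w x) :=
  ⟨hu.smooth.add hw.smooth, hu.compact.add hw.compact,
    (tsupport_add u w).trans (union_subset hu.support_subset hw.support_subset)⟩

lemma const_mul (c : ℝ) (hw : IsTestFunction Ω w) : IsTestFunction Ω (fun x => c * w x) :=
  ⟨contDiff_const.mul hw.smooth, hw.compact.mul_left,
    (tsupport_mul_subset_right (f := fun _ => c)).trans hw.support_subset⟩

lemma fderiv_apply (hw : IsTestFunction Ω w) (e : Eu d) :
    IsTestFunction Ω (fun x => fderiv ℝ w x e) :=
  ⟨(hw.smooth.fderiv_right (by simp)).clm_apply contDiff_const,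
    hw.compact.fderiv_apply ℝ e,
    (tsupport_fderiv_apply_subset ℝ e).trans hw.support_subset⟩

lemma comp_add_right {Ω' : Set (Eu d)} (hw : IsTestFunction Ω w) (y : Eu d)
    (h : ∀ x, x + y ∈ tsupport w → x ∈ Ω') : IsTestFunction Ω' (fun x => w (x + y)) := by
  have ht : tsupport (fun x => w (x + y)) ⊆ (Homeomorph.addRight y) ⁻¹' tsupport w :=
    closure_minimal (fun x hx => subset_closure hx)
      ((isClosed_tsupport w).preimage (Homeomorph.addRight y).continuous)
  exact ⟨hw.smooth.comp (contDiff_id.add contDiff_const),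
    hw.compact.comp_homeomorph (Homeomorph.addRight y), ht.trans h⟩

/-- Classical integration by parts against a test function. -/
lemma integral_mul_fderiv_eq_neg (hw : IsTestFunction Ω w) (hu : ContDiff ℝ ∞ u) (e : Eu d) :
    ∫ x, u x * fderiv ℝ w x e = - ∫ x, fderiv ℝ u x e * w x := by
  have hu' : Continuous fun x => fderiv ℝ u x e :=
    ((hu.fderiv_right (m := ∞) (by simp)).clm_apply contDiff_const).continuous
  have hw' := hw.fderiv_apply e
  refine integral_mul_fderiv_eq_neg_fderiv_mul_of_integrable
    ((hu'.mul hw.smooth.continuous).integrable_of_hasCompactSupport hw.compact.mul_left)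
    ((hu.continuous.mul hw'.smooth.continuous).integrable_of_hasCompactSupport
      hw'.compact.mul_left)
    ((hu.continuous.mul hw.smooth.continuous).integrable_of_hasCompactSupport
      hw.compact.mul_left)
    (fun x _ => (hu.differentiable (by simp)) x) (fun x _ => hw.differentiable x)

end IsTestFunction

/-- The defining identity of a weak gradient, written in coordinates. -/
lemma hasH1Gradient_iff_integral_fderiv {g : Eu d → Eu d} (hu : MemLp u 2 (volume.restrict Ω))
    (hg : MemLp g 2 (volume.restrict Ω)) :
    HasH1Gradient Ω u g ↔ ∀ w : Eu d → ℝ, IsTestFunction Ω w → ∀ i : Fin d,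
      ∫ x in Ω, u x * fderiv ℝ w x (EuclideanSpace.single i 1) = - ∫ x in Ω, w x * g x i := by
  have key (w : Eu d → ℝ) (hw : IsTestFunction Ω w) (i : Fin d) :
      (∫ x in Ω, u x • ∇ w x) i = ∫ x in Ω, u x * fderiv ℝ w x (EuclideanSpace.single i 1) ∧
      (∫ x in Ω, w x • g x) i = ∫ x in Ω, w x * g x i := by
    have h1 : Integrable (fun x => u x • ∇ w x) (volume.restrict Ω) :=
      memLp_one_iff_integrable.1 ((hw.memLp_gradient (volume.restrict Ω)).smul hu (r := 1))
    have h2 : Integrable (fun x => w x • g x) (volume.restrict Ω) :=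
      memLp_one_iff_integrable.1 (hg.smul (hw.memLp (volume.restrict Ω)) (r := 1))
    have e1 := (EuclideanSpace.proj i : Eu d →L[ℝ] ℝ).integral_comp_comm h1
    have e2 := (EuclideanSpace.proj i : Eu d →L[ℝ] ℝ).integral_comp_comm h2
    simp only [PiLp.proj_apply, PiLp.smul_apply, smul_eq_mul, gradient_apply_eq_fderiv] at e1 e2
    exact ⟨e1.symm, e2.symm⟩
  refine ⟨fun h w hw i => ?_, fun h => ⟨hu, hg, fun w hw => ?_⟩⟩
  · rw [← (key w hw i).1, h.integral_eq w hw, PiLp.neg_apply, (key w hw i).2]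
  · ext i
    rw [PiLp.neg_apply, (key w hw i).1, (key w hw i).2, h w hw i]

/-- A smooth function with compact support has its classical gradient as its weak gradient. -/
lemma hasH1Gradient_of_contDiff (Ω : Set (Eu d)) (hu : ContDiff ℝ ∞ u)
    (hc : HasCompactSupport u) : HasH1Gradient Ω u (∇ u) := by
  -- `u` need not be supported in `Ω`; it is `w` that vanishes outside, so both integrals extend to
  -- the whole space.
  have hT : IsTestFunction univ u := ⟨hu, hc, subset_univ _⟩
  refine (hasH1Gradient_iff_integral_fderiv (hT.memLp _) (hT.memLp_gradient _)).2
    fun w hw i => ?_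
  rw [setIntegral_eq_integral_of_forall_compl_eq_zero fun x hx => by
      rw [(hw.fderiv_apply _).eq_zero_of_notMem hx, mul_zero],
    setIntegral_eq_integral_of_forall_compl_eq_zero fun x hx => by
      rw [hw.eq_zero_of_notMem hx, zero_mul],
    hw.integral_mul_fderiv_eq_neg hu]
  simp_rw [gradient_apply_eq_fderiv, mul_comm]

/-- The distributional Laplacian of a function with weak gradient `g`. -/
lemma HasH1Gradient.integral_mul_laplacian {g : Eu d → Eu d} (hu : HasH1Gradient Ω u g)
    (hw : IsTestFunction Ω w) :
    ∫ x in Ω, u x * (Δ w) x = - ∫ x in Ω, ⟪g x, ∇ w x⟫_ℝ := by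
  -- The weak gradient identity is applied to each `∂ᵢw`, itself a test function, and summed over
  -- `i`.
  have hp (i : Fin d) := hw.fderiv_apply (EuclideanSpace.single i 1)
  have j1 (i : Fin d) : Integrable (fun x => u x * fderiv ℝ (fun y => fderiv ℝ w y
      (EuclideanSpace.single i 1)) x (EuclideanSpace.single i 1)) (volume.restrict Ω) :=
    hu.memLp.integrable_mul (((hp i).fderiv_apply _).memLp _)
  have j2 (i : Fin d) : Integrable (fun x => fderiv ℝ w x (EuclideanSpace.single i 1) * g x i)
      (volume.restrict Ω) :=
    ((hp i).memLp _).integrable_mul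
      ((EuclideanSpace.proj i : Eu d →L[ℝ] ℝ).comp_memLp' hu.memLp_gradient)
  simp_rw [laplacian_eq_sum_fderiv_fderiv hw.smooth, Finset.mul_sum]
  rw [integral_finsetSum _ fun i _ => j1 i, Finset.sum_congr rfl fun i _ =>
    (hasH1Gradient_iff_integral_fderiv hu.memLp hu.memLp_gradient).1 hu _ (hp i) i,
    Finset.sum_neg_distrib, ← integral_finsetSum _ fun i _ => j2 i]
  simp_rw [PiLp.inner_apply, gradient_apply_eq_fderiv]
  simp

/-- Poincaré's inequality for test functions. -/
lemma IsTestFunction.integral_sq_le {R : ℝ} (hw : IsTestFunction Ω w) (hΩ : ∀ x ∈ Ω, ‖x‖ ≤ R)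
    (i : Fin d) :
    ∫ x in Ω, w x ^ 2 ≤ (2 * R) ^ 2 * ∫ x in Ω, ‖∇ w x‖ ^ 2 := by
  have hw2 : IsTestFunction Ω fun x => w x ^ 2 := by
    refine ⟨hw.smooth.pow 2, hw.compact.comp_left (g := fun t => t ^ 2) (by simp), ?_⟩
    refine Subset.trans (closure_mono ?_) hw.support_subset
    exact fun x (hx : w x ^ 2 ≠ 0) (hx0 : w x = 0) => hx (by simp [hx0])
  -- Integration by parts against the coordinate `x i`, whose derivative in direction `i` is `1` and
  -- whose size on `Ω` is at most `R`.
  have h0 : ∫ x, w x ^ 2 = - ∫ x, x i * (2 * w x * fderiv ℝ w x (EuclideanSpace.single i 1)) := by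
    have := hw2.integral_mul_fderiv_eq_neg (u := fun x => x i)
      (EuclideanSpace.proj i : Eu d →L[ℝ] ℝ).contDiff (EuclideanSpace.single i 1)
    have e1 (x : Eu d) : fderiv ℝ (fun x : Eu d => x i) x (EuclideanSpace.single i 1) = 1 := by
      have h1 : HasFDerivAt (fun x : Eu d => x i) (EuclideanSpace.proj i : Eu d →L[ℝ] ℝ) x :=
        (EuclideanSpace.proj i : Eu d →L[ℝ] ℝ).hasFDerivAt
      rw [h1.fderiv]
      simp
    have e2 (x : Eu d) : fderiv ℝ (fun x : Eu d => w x ^ 2) x (EuclideanSpace.single i 1)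
        = 2 * w x * fderiv ℝ w x (EuclideanSpace.single i 1) := by
      rw [fderiv_fun_pow _ (hw.differentiable x)]
      simp
    simp_rw [e1, e2, one_mul] at this
    rw [this, neg_neg]
  have i1 : Integrable fun x => w x ^ 2 := (hw.memLp volume).integrable_sq
  have i2 : Integrable fun x => ‖∇ w x‖ ^ 2 := (hw.memLp_gradient volume).norm.integrable_sq
  have i3 : Integrable fun x => -(x i * (2 * w x * fderiv ℝ w x (EuclideanSpace.single i 1))) := by
    have := ((EuclideanSpace.proj i : Eu d →L[ℝ] ℝ).continuous.mul
      (((continuous_const (y := (2 : ℝ))).mul hw.smooth.continuous).mul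
        (hw.fderiv_apply (EuclideanSpace.single i 1)).smooth.continuous))
    exact (this.integrable_of_hasCompactSupport
      ((hw.fderiv_apply (EuclideanSpace.single i 1)).compact.mul_left.mul_left)).neg
  have hle : ∫ x, w x ^ 2 ≤ ∫ x, (w x ^ 2 / 2 + 2 * R ^ 2 * ‖∇ w x‖ ^ 2) := by
    conv_lhs => rw [h0, ← integral_neg]
    refine integral_mono i3 ((i1.div_const 2).add (i2.const_mul _)) fun x => ?_
    dsimp only
    by_cases hx : x ∈ Ω
    · have b1 : |x i| ≤ R := (PiLp.norm_apply_le x i).trans (hΩ x hx)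
      have b2 : |fderiv ℝ w x (EuclideanSpace.single i 1)| ≤ ‖∇ w x‖ := by
        rw [← gradient_apply_eq_fderiv]
        exact PiLp.norm_apply_le (∇ w x) i
      have b3 : (x i * fderiv ℝ w x (EuclideanSpace.single i 1)) ^ 2 ≤ (R * ‖∇ w x‖) ^ 2 := by
        rw [← sq_abs, abs_mul]
        gcongr
        exact (abs_nonneg _).trans b1
      -- Young's inequality with weight chosen to leave `w² / 2`, which the left side absorbs.
      nlinarith [sq_nonneg (w x + 2 * (x i * fderiv ℝ w x (EuclideanSpace.single i 1)))]
    · rw [hw.eq_zero_of_notMem hx]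
      have : 0 ≤ 2 * R ^ 2 * ‖∇ w x‖ ^ 2 := by positivity
      simpa using this
  rw [integral_add (i1.div_const 2) (i2.const_mul _), integral_div, integral_const_mul] at hle
  rw [setIntegral_eq_integral_of_forall_compl_eq_zero fun x hx => by
      rw [hw.eq_zero_of_notMem hx]; simp,
    setIntegral_eq_integral_of_forall_compl_eq_zero fun x hx => by
      rw [hw.gradient_eq_zero_of_notMem hx]; simp]
  linarith

end Gradient

/-! ### `H¹₀(Ω)` as a closed subspace of a Hilbert space -/

section H1Pair

variable {d : ℕ} {Ω : Set (Eu d)} {u u' w : Eu d → ℝ} {g g' : Eu d → Eu d}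

/-- The Hilbert space of pairs of a function and a vector field, both square integrable. -/
abbrev H1Pair (Ω : Set (Eu d)) : Type :=
  WithLp 2 (Lp ℝ 2 (volume.restrict Ω) × Lp (Eu d) 2 (volume.restrict Ω))

/-- The class of a function and a vector field in `H1Pair Ω`. -/
noncomputable def h1Pair (hu : MemLp u 2 (volume.restrict Ω))
    (hg : MemLp g 2 (volume.restrict Ω)) : H1Pair Ω :=
  WithLp.toLp 2 (hu.toLp u, hg.toLp g)

lemma inner_toLp {E : Type*} [NormedAddCommGroup E] [InnerProductSpace ℝ E] {α : Type*}
    [MeasurableSpace α] {μ : Measure α} {f h : α → E} (hf : MemLp f 2 μ) (hh : MemLp h 2 μ) :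
    ⟪hf.toLp f, hh.toLp h⟫_ℝ = ∫ x, ⟪f x, h x⟫_ℝ ∂μ := by
  rw [L2.inner_def]
  refine integral_congr_ae ?_
  filter_upwards [hf.coeFn_toLp, hh.coeFn_toLp] with x h1 h2
  rw [h1, h2]

lemma integrable_inner_of_memLp {E : Type*} [NormedAddCommGroup E] [InnerProductSpace ℝ E]
    {α : Type*} [MeasurableSpace α] {μ : Measure α} {f h : α → E} (hf : MemLp f 2 μ)
    (hh : MemLp h 2 μ) : Integrable (fun x => ⟪f x, h x⟫_ℝ) μ := by
  refine (L2.integrable_inner (𝕜 := ℝ) (hf.toLp f) (hh.toLp h)).congr ?_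
  filter_upwards [hf.coeFn_toLp, hh.coeFn_toLp] with x h1 h2
  rw [h1, h2]

lemma norm_toLp_sq {E : Type*} [NormedAddCommGroup E] [InnerProductSpace ℝ E] {α : Type*}
    [MeasurableSpace α] {μ : Measure α} {f : α → E} (hf : MemLp f 2 μ) :
    ‖hf.toLp f‖ ^ 2 = ∫ x, ‖f x‖ ^ 2 ∂μ := by
  rw [← real_inner_self_eq_norm_sq, inner_toLp]
  simp_rw [real_inner_self_eq_norm_sq]

lemma h1Pair_fst (hu : MemLp u 2 (volume.restrict Ω)) (hg : MemLp g 2 (volume.restrict Ω)) :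
    (h1Pair hu hg).fst = hu.toLp u := rfl

lemma h1Pair_snd (hu : MemLp u 2 (volume.restrict Ω)) (hg : MemLp g 2 (volume.restrict Ω)) :
    (h1Pair hu hg).snd = hg.toLp g := rfl

lemma norm_h1Pair (hu : MemLp u 2 (volume.restrict Ω)) (hg : MemLp g 2 (volume.restrict Ω)) :
    ‖h1Pair hu hg‖ = h1Norm Ω u g := by
  rw [h1Norm, ← Real.sqrt_sq (norm_nonneg (h1Pair hu hg)), WithLp.prod_norm_sq_eq_of_L2]
  change √(‖hu.toLp u‖ ^ 2 + ‖hg.toLp g‖ ^ 2) = _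
  simp only [norm_toLp_sq, Real.norm_eq_abs, sq_abs]

lemma h1Pair_sub (hu : MemLp u 2 (volume.restrict Ω)) (hg : MemLp g 2 (volume.restrict Ω))
    (hu' : MemLp u' 2 (volume.restrict Ω)) (hg' : MemLp g' 2 (volume.restrict Ω)) :
    h1Pair hu hg - h1Pair hu' hg' = h1Pair (hu.sub hu') (hg.sub hg') := by
  rfl

lemma h1Pair_congr (hu : MemLp u 2 (volume.restrict Ω)) (hg : MemLp g 2 (volume.restrict Ω))
    (hu' : MemLp u' 2 (volume.restrict Ω)) (hg' : MemLp g' 2 (volume.restrict Ω))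
    (h1 : u =ᵐ[volume.restrict Ω] u') (h2 : g =ᵐ[volume.restrict Ω] g') :
    h1Pair hu hg = h1Pair hu' hg' := by
  simp only [h1Pair, MemLp.toLp_congr hu hu' h1, MemLp.toLp_congr hg hg' h2]

/-- The pair of a test function and its gradient. -/
noncomputable def IsTestFunction.pair (hw : IsTestFunction Ω w) : H1Pair Ω :=
  h1Pair (hw.memLp _) (hw.memLp_gradient _)

/-- The subspace of the pairs of a test function and its gradient. -/
noncomputable def testPairs (Ω : Set (Eu d)) : Submodule ℝ (H1Pair Ω) where
  carrier := {z | ∃ (w : Eu d → ℝ) (hw : IsTestFunction Ω w), z = hw.pair}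
  zero_mem' := by
    refine ⟨_, IsTestFunction.zero Ω, ?_⟩
    have h0 : (∇ fun _ : Eu d => (0 : ℝ)) = fun _ => 0 := gradient_fun_const' 0
    symm
    rw [← norm_eq_zero, IsTestFunction.pair, norm_h1Pair, h1Norm, h0]
    simp
  add_mem' := by
    rintro _ _ ⟨w, hw, rfl⟩ ⟨w', hw', rfl⟩
    refine ⟨_, hw.add hw', ?_⟩
    have : h1Pair (hw.memLp (volume.restrict Ω)) (hw.memLp_gradient _) +
        h1Pair (hw'.memLp (volume.restrict Ω)) (hw'.memLp_gradient _) =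
        h1Pair ((hw.memLp _).add (hw'.memLp _))
          ((hw.memLp_gradient _).add (hw'.memLp_gradient _)) := by
      rfl
    refine this.trans (h1Pair_congr _ _ _ _ (.of_eq rfl) (.of_eq ?_))
    exact (gradient_add' hw.differentiable hw'.differentiable).symm
  smul_mem' := by
    rintro c _ ⟨w, hw, rfl⟩
    refine ⟨_, hw.const_mul c, ?_⟩
    have : c • h1Pair (hw.memLp (volume.restrict Ω)) (hw.memLp_gradient _) =
        h1Pair ((hw.memLp _).const_smul c) ((hw.memLp_gradient _).const_smul c) := by
      rfl
    refine this.trans (h1Pair_congr _ _ _ _ (.of_eq rfl) (.of_eq ?_))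
    exact (gradient_const_mul c hw.differentiable).symm

lemma IsTestFunction.pair_mem (hw : IsTestFunction Ω w) : hw.pair ∈ testPairs Ω := ⟨w, hw, rfl⟩

/-- The weak gradient relation passes to the closure of the test functions. -/
lemma hasH1Gradient_of_mem_closure (hu : MemLp u 2 (volume.restrict Ω))
    (hg : MemLp g 2 (volume.restrict Ω))
    (h : h1Pair hu hg ∈ (testPairs Ω).topologicalClosure) : HasH1Gradient Ω u g := by
  rw [hasH1Gradient_iff_integral_fderiv hu hg]
  intro w hw i
  have hw1 := (hw.fderiv_apply (EuclideanSpace.single i 1)).memLp (volume.restrict Ω)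
  have hw2 : MemLp (fun x => w x • (EuclideanSpace.single i 1 : Eu d)) 2 (volume.restrict Ω) := by
    refine (hw.smooth.continuous.smul continuous_const).memLp_of_hasCompactSupport
      hw.compact.smul_right
  have hpair {u : Eu d → ℝ} {g : Eu d → Eu d} (hu : MemLp u 2 (volume.restrict Ω))
      (hg : MemLp g 2 (volume.restrict Ω)) :
      ⟪hw1.toLp _, (h1Pair hu hg).fst⟫_ℝ =
        ∫ x in Ω, u x * fderiv ℝ w x (EuclideanSpace.single i 1) ∧
      ⟪hw2.toLp _, (h1Pair hu hg).snd⟫_ℝ = ∫ x in Ω, w x * g x i := by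
    refine ⟨(inner_toLp hw1 hu).trans ?_, (inner_toLp hw2 hg).trans ?_⟩
    · simp
    · simp [inner_smul_left, EuclideanSpace.inner_single_left]
  rw [← (hpair hu hg).1, ← (hpair hu hg).2]
  -- Both sides are inner products with fixed elements of `L²`, so the identity survives limits.
  have hcl : IsClosed {z : H1Pair Ω | ⟪hw1.toLp _, z.fst⟫_ℝ = - ⟪hw2.toLp _, z.snd⟫_ℝ} :=
    isClosed_eq (continuous_const.inner (WithLp.fstL 2 ℝ _ _).continuous)
      (continuous_const.inner (WithLp.sndL 2 ℝ _ _).continuous).neg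
  refine closure_minimal ?_ hcl h
  rintro _ ⟨w', hw', rfl⟩
  have := (hpair (hw'.memLp _) (hw'.memLp_gradient _))
  rw [mem_ofPred_eq, IsTestFunction.pair, this.1, this.2]
  exact (hasH1Gradient_iff_integral_fderiv (hw'.memLp _) (hw'.memLp_gradient _)).1
    (hasH1Gradient_of_contDiff Ω hw'.smooth hw'.compact) w hw i

/-- Membership in the closure already forces the weak gradient relation, so `H¹₀` can be handled by
Hilbert space arguments alone. -/
lemma hasH10Gradient_iff_mem_closure (hu : MemLp u 2 (volume.restrict Ω))
    (hg : MemLp g 2 (volume.restrict Ω)) :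
    HasH10Gradient Ω u g ↔ h1Pair hu hg ∈ (testPairs Ω).topologicalClosure := by
  have hdist {w : Eu d → ℝ} (hw : IsTestFunction Ω w) : dist (h1Pair hu hg) hw.pair =
      h1Norm Ω (fun x => u x - w x) (fun x => g x - ∇ w x) := by
    rw [dist_eq_norm, IsTestFunction.pair, h1Pair_sub, norm_h1Pair]
    rfl
  constructor
  · intro h
    refine Metric.mem_closure_iff.2 fun ε hε => ?_
    obtain ⟨w, hw, hlt⟩ := h.mem_closure ε hε
    exact ⟨hw.pair, hw.pair_mem, (hdist hw).trans_lt hlt⟩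
  · intro h
    refine ⟨hasH1Gradient_of_mem_closure hu hg h, fun ε hε => ?_⟩
    obtain ⟨_, ⟨w, hw, rfl⟩, hlt⟩ := Metric.mem_closure_iff.1 h ε hε
    exact ⟨w, hw, (hdist hw).symm.trans_lt hlt⟩

lemma HasH10Gradient.sub (h : HasH10Gradient Ω u g) (h' : HasH10Gradient Ω u' g') :
    HasH10Gradient Ω (u - u') (g - g') := by
  have a := h.hasH1Gradient
  have a' := h'.hasH1Gradient
  rw [hasH10Gradient_iff_mem_closure (a.memLp.sub a'.memLp)
    (a.memLp_gradient.sub a'.memLp_gradient), ← h1Pair_sub a.memLp a.memLp_gradient a'.memLp a'.memLp_gradient]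
  exact Submodule.sub_mem _
    ((hasH10Gradient_iff_mem_closure a.memLp a.memLp_gradient).1 h)
    ((hasH10Gradient_iff_mem_closure a'.memLp a'.memLp_gradient).1 h')

/-- Poincaré's inequality on the closure of the test functions. -/
lemma norm_fst_le_of_mem_closure {R : ℝ} (hR : ∀ x ∈ Ω, ‖x‖ ≤ R) (i : Fin d) {z : H1Pair Ω}
    (hz : z ∈ (testPairs Ω).topologicalClosure) : ‖z.fst‖ ^ 2 ≤ (2 * R) ^ 2 * ‖z.snd‖ ^ 2 := by
  have h1 : Continuous fun z : H1Pair Ω => ‖z.fst‖ := (WithLp.fstL 2 ℝ _ _).continuous.norm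
  have h2 : Continuous fun z : H1Pair Ω => ‖z.snd‖ := (WithLp.sndL 2 ℝ _ _).continuous.norm
  have hcl : IsClosed {z : H1Pair Ω | ‖z.fst‖ ^ 2 ≤ (2 * R) ^ 2 * ‖z.snd‖ ^ 2} :=
    isClosed_le (h1.pow 2) (continuous_const.mul (h2.pow 2))
  refine closure_minimal ?_ hcl hz
  rintro _ ⟨w, hw, rfl⟩
  have e1 : ‖hw.pair.fst‖ ^ 2 = ∫ x in Ω, w x ^ 2 := by
    refine (norm_toLp_sq (hw.memLp (volume.restrict Ω))).trans ?_
    simp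
  have e2 : ‖hw.pair.snd‖ ^ 2 = ∫ x in Ω, ‖∇ w x‖ ^ 2 :=
    norm_toLp_sq (hw.memLp_gradient (volume.restrict Ω))
  rw [mem_ofPred_eq, e1, e2]
  exact hw.integral_sq_le hR i

/-- The only weakly harmonic element of `H¹₀(Ω)` is zero. -/
lemma HasH10Gradient.ae_eq_zero (h : HasH10Gradient Ω u g) (hΩ : Bornology.IsBounded Ω)
    (hd : 0 < d) (h0 : ∀ w : Eu d → ℝ, IsTestFunction Ω w → ∫ x in Ω, ⟪g x, ∇ w x⟫_ℝ = 0) :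
    u =ᵐ[volume.restrict Ω] 0 := by
  have hu := h.hasH1Gradient.memLp
  have hg := h.hasH1Gradient.memLp_gradient
  have hmem := (hasH10Gradient_iff_mem_closure hu hg).1 h
  have h1 : Continuous fun z : H1Pair Ω => ⟪hg.toLp g, z.snd⟫_ℝ :=
    continuous_const.inner (WithLp.sndL 2 ℝ _ _).continuous
  -- By density the gradient may be tested against itself, which gives `g = 0`.
  have hg1 : ⟪hg.toLp g, (h1Pair hu hg).snd⟫_ℝ = 0 := by
    have hcl : IsClosed {z : H1Pair Ω | ⟪hg.toLp g, z.snd⟫_ℝ = 0} :=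
      isClosed_eq h1 continuous_const
    refine closure_minimal ?_ hcl hmem
    rintro _ ⟨w, hw, rfl⟩
    rw [mem_ofPred_eq, IsTestFunction.pair, h1Pair_snd, inner_toLp, h0 w hw]
  obtain ⟨R, hR⟩ := hΩ.exists_norm_le
  have hP := norm_fst_le_of_mem_closure hR ⟨0, hd⟩ hmem
  rw [h1Pair_snd, inner_self_eq_zero] at hg1
  rw [h1Pair_fst, h1Pair_snd, hg1, norm_zero] at hP
  have hu0 : hu.toLp u = 0 := by
    rw [← norm_eq_zero, ← sq_eq_zero_iff]
    exact le_antisymm (by simpa using hP) (sq_nonneg _)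
  filter_upwards [hu.coeFn_toLp, Lp.coeFn_zero ℝ 2 (volume.restrict Ω)] with x h2 h3
  rw [← h2, hu0, h3]

/-- A function which is approximated in `L²` by a family of test functions bounded in `H¹`
belongs to `H¹₀`. -/
lemma memH10_of_bounded_approx (hu : MemLp u 2 (volume.restrict Ω)) (C : ℝ)
    (h : ∀ ε : ℝ, 0 < ε → ∃ w : Eu d → ℝ, IsTestFunction Ω w ∧ h1Norm Ω w (∇ w) ≤ C ∧
      ∫ x in Ω, (w x - u x) ^ 2 ≤ ε ^ 2) : MemH10 Ω u := by
  obtain ⟨z, hz, hzu⟩ := exists_mem_map_eq_of_bounded_approx (testPairs Ω).topologicalClosure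
    (testPairs Ω).isClosed_topologicalClosure (WithLp.fstL 2 ℝ _ _) (hu.toLp u) C fun ε hε => by
      obtain ⟨w, hw, hwC, hwu⟩ := h ε hε
      refine ⟨hw.pair, subset_closure hw.pair_mem, (norm_h1Pair _ _).trans_le hwC, ?_⟩
      change ‖(hw.memLp _).toLp w - hu.toLp u‖ ≤ ε
      rw [← MemLp.toLp_sub]
      refine (pow_le_pow_iff_left₀ (norm_nonneg _) hε.le two_ne_zero).1 ?_
      rw [norm_toLp_sq]
      simpa using hwu
  refine ⟨z.snd, (hasH10Gradient_iff_mem_closure hu (Lp.memLp z.snd)).2 ?_⟩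
  have : h1Pair hu (Lp.memLp z.snd) = z := by
    simp only [h1Pair, Lp.toLp_coeFn, ← hzu]
    rfl
  rwa [this]

end H1Pair

/-! ### Smooth truncation -/

/-- A smooth monotone function which vanishes near zero and is uniformly close to the identity. -/
lemma exists_smooth_truncation {ε : ℝ} (hε : 0 < ε) : ∃ f s : ℝ → ℝ, ContDiff ℝ ∞ f ∧
    (∀ t, HasDerivAt f (s t) t) ∧ (∀ t, 0 ≤ s t) ∧ (∀ t, s t ≤ 1) ∧
    (∀ t, |t| ≤ ε → f t = 0) ∧ ∀ t, |f t - t| ≤ 2 * ε := by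
  -- Using `t ^ 2` makes `s` even and smooth at zero; it is `0` for `|t| ≤ ε` and `1` for `|t| ≥ 2 *
  -- ε`. Then `f` is its primitive.
  let s : ℝ → ℝ := fun t => Real.smoothTransition (t ^ 2 / ε ^ 2 - 1)
  have hs : ContDiff ℝ ∞ s := Real.smoothTransition.contDiff.comp
    (((contDiff_id.pow 2).div_const _).sub contDiff_const)
  have hs0 (t : ℝ) (ht : |t| ≤ ε) : s t = 0 := by
    refine Real.smoothTransition.zero_of_nonpos ?_
    rw [sub_nonpos, div_le_one (by positivity)]
    exact sq_le_sq' (by linarith [neg_abs_le t]) (by linarith [le_abs_self t])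
  have hs1 (t : ℝ) (ht : 2 * ε ≤ |t|) : s t = 1 := by
    refine Real.smoothTransition.one_of_one_le ?_
    rw [le_sub_iff_add_le, le_div_iff₀ (by positivity), ← sq_abs t]
    nlinarith
  have hf (t : ℝ) : HasDerivAt (fun t => ∫ x in (0 : ℝ)..t, s x) (s t) t :=
    (hs.continuous.integral_hasStrictDerivAt 0 t).hasDerivAt
  have hs_nn (t : ℝ) : 0 ≤ s t := Real.smoothTransition.nonneg _
  have hs_le (t : ℝ) : s t ≤ 1 := Real.smoothTransition.le_one _
  set f : ℝ → ℝ := fun t => ∫ x in (0 : ℝ)..t, s x with hfdef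
  have f0 : f 0 = 0 := by simp [hfdef]
  have hh (t : ℝ) : HasDerivAt (fun t => f t - t) (s t - 1) t := (hf t).sub (hasDerivAt_id t)
  have hh1 (t : ℝ) : |f t - t| ≤ |t| := by
    have := convex_univ.norm_image_sub_le_of_norm_hasDerivWithin_le (C := 1)
      (fun x _ => (hh x).hasDerivWithinAt)
      (fun x _ => by rw [Real.norm_eq_abs, abs_le]; constructor <;> linarith [hs_nn x, hs_le x])
      (mem_univ 0) (mem_univ t)
    simpa [f0] using this
  -- On each ray `|x| ≥ 2 * ε` the difference `f - id` is constant, so its value at the endpoint `a`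
  -- decides.
  have hh2 (a t : ℝ) (S : Set ℝ) (hS : Convex ℝ S) (ha : a ∈ S) (ht : t ∈ S) (ha' : |a| = 2 * ε)
      (h : ∀ x ∈ S, 2 * ε ≤ |x|) : |f t - t| ≤ 2 * ε := by
    have := hS.norm_image_sub_le_of_norm_hasDerivWithin_le (C := 0)
      (fun x _ => (hh x).hasDerivWithinAt) (fun x hx => by simp [hs1 x (h x hx)]) ha ht
    rw [zero_mul, norm_le_zero_iff, sub_eq_zero] at this
    rw [this]
    exact (hh1 a).trans ha'.le
  refine ⟨f, s, ?_, hf, hs_nn, hs_le, fun t ht => ?_, fun t => ?_⟩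
  · rw [contDiff_infty_iff_deriv]
    exact ⟨fun t => (hf t).differentiableAt, by rwa [funext fun t => (hf t).deriv]⟩
  · have := (convex_Icc (-ε) ε).norm_image_sub_le_of_norm_hasDerivWithin_le (C := 0)
      (fun x _ => (hf x).hasDerivWithinAt) (fun x hx => by simp [hs0 x (abs_le.2 hx)])
      (x := 0) (y := t) ⟨by linarith, hε.le⟩ (abs_le.1 ht)
    simpa [f0] using this
  · rcases le_total |t| (2 * ε) with h | h
    · exact (hh1 t).trans h
    · rcases le_abs'.1 h with h | h
      · refine hh2 (-(2 * ε)) t (Iic (-(2 * ε))) (convex_Iic _) self_mem_Iic h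
          (by rw [abs_neg, abs_of_pos (by positivity)]) fun x hx => ?_
        exact le_abs'.2 (Or.inl hx)
      · refine hh2 (2 * ε) t (Ici (2 * ε)) (convex_Ici _) self_mem_Ici h
          (abs_of_pos (by positivity)) fun x hx => ?_
        exact le_abs'.2 (Or.inr hx)

/-! ### Energy estimate and mollification -/

section Energy

variable {d : ℕ} {Ω : Set (Eu d)} {u v w : Eu d → ℝ}

/-- The energy estimate for a truncation `f ∘ u` of a function `u` whose Laplacian is bounded in
`H⁻¹` when tested with that truncation. -/
lemma integral_gradient_truncation_sq_le {f s : ℝ → ℝ} {M : ℝ} (hu : ContDiff ℝ ∞ u)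
    (hc : HasCompactSupport u) (hf : ∀ t, HasDerivAt f (s t) t) (hs0 : ∀ t, 0 ≤ s t)
    (hs1 : ∀ t, s t ≤ 1) (hw : IsTestFunction Ω fun x => f (u x))
    (hM : |∫ x in Ω, u x * (Δ fun x => f (u x)) x| ≤
      M * h1Norm Ω (fun x => f (u x)) (∇ fun x => f (u x))) :
    ∫ x in Ω, ‖∇ (fun x => f (u x)) x‖ ^ 2 ≤ M ^ 2 + ∫ x in Ω, f (u x) ^ 2 := by
  have hU := hasH1Gradient_of_contDiff Ω hu hc
  have hgrad (x : Eu d) : ∇ (fun x => f (u x)) x = s (u x) • ∇ u x := by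
    have h1 := (hf (u x)).comp_hasFDerivAt x ((hu.differentiable (by simp)) x).hasFDerivAt
    have h2 : fderiv ℝ (fun x => f (u x)) x = s (u x) • fderiv ℝ u x := h1.fderiv
    simp [_root_.gradient, h2]
  have i1 : Integrable (fun x => ‖∇ (fun x => f (u x)) x‖ ^ 2) (volume.restrict Ω) :=
    (hw.memLp_gradient _).norm.integrable_sq
  have i2 : Integrable (fun x => ⟪∇ u x, ∇ (fun x => f (u x)) x⟫_ℝ) (volume.restrict Ω) :=
    integrable_inner_of_memLp hU.memLp_gradient (hw.memLp_gradient _)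
  have h1 : ∫ x in Ω, ‖∇ (fun x => f (u x)) x‖ ^ 2 ≤
      ∫ x in Ω, ⟪∇ u x, ∇ (fun x => f (u x)) x⟫_ℝ := by
    refine integral_mono i1 i2 fun x => ?_
    dsimp only
    rw [hgrad, norm_smul, inner_smul_right, real_inner_self_eq_norm_sq, mul_pow, Real.norm_eq_abs,
      sq_abs]
    exact mul_le_mul_of_nonneg_right (by nlinarith [hs0 (u x), hs1 (u x)]) (sq_nonneg _)
  have h2 := hU.integral_mul_laplacian hw
  have h3 := (neg_abs_le (∫ x in Ω, u x * (Δ fun x => f (u x)) x))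
  have h4 : 0 ≤ (∫ x in Ω, f (u x) ^ 2) + ∫ x in Ω, ‖∇ (fun x => f (u x)) x‖ ^ 2 :=
    add_nonneg (integral_nonneg fun x => sq_nonneg _) (integral_nonneg fun x => sq_nonneg _)
  have h5 := Real.sq_sqrt h4
  rw [h1Norm] at hM
  -- With `X` the gradient integral and `A` the integral of `f(u)²`, `X ≤ M √(A + X) ≤ (M² + A + X)
  -- / 2`.
  nlinarith [sq_nonneg (M - √((∫ x in Ω, f (u x) ^ 2) +
    ∫ x in Ω, ‖∇ (fun x => f (u x)) x‖ ^ 2))]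

lemma gradient_comp_add_right (w : Eu d → ℝ) (y x : Eu d) :
    ∇ (fun x => w (x + y)) x = ∇ w (x + y) := by
  simp [_root_.gradient, fderiv_comp_add_right]

lemma laplacian_comp_add_right (hw : ContDiff ℝ ∞ w) (y x : Eu d) :
    (Δ fun x => w (x + y)) x = (Δ w) (x + y) := by
  rw [laplacian_eq_sum_fderiv_fderiv hw, laplacian_eq_sum_fderiv_fderiv
    (w := fun x => w (x + y)) (hw.comp (contDiff_id.add contDiff_const))]
  refine Finset.sum_congr rfl fun i _ => ?_
  simp_rw [fderiv_comp_add_right]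
  rw [fderiv_comp_add_right (f := fun z => fderiv ℝ w z (EuclideanSpace.single i 1))]

/-- Integrals over the whole space make translation invariance available. -/
lemma IsTestFunction.h1Norm_eq (hw : IsTestFunction Ω w) :
    h1Norm Ω w (∇ w) = √((∫ x, w x ^ 2) + ∫ x, ‖∇ w x‖ ^ 2) := by
  rw [h1Norm, setIntegral_eq_integral_of_forall_compl_eq_zero fun x hx => by
      rw [hw.eq_zero_of_notMem hx]; simp,
    setIntegral_eq_integral_of_forall_compl_eq_zero fun x hx => by
      rw [hw.gradient_eq_zero_of_notMem hx]; simp]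

lemma IsTestFunction.h1Norm_comp_add_right (hw : IsTestFunction Ω w) {y : Eu d}
    (hwy : IsTestFunction Ω fun x => w (x + y)) :
    h1Norm Ω (fun x => w (x + y)) (∇ fun x => w (x + y)) = h1Norm Ω w (∇ w) := by
  rw [hw.h1Norm_eq, hwy.h1Norm_eq]
  simp_rw [gradient_comp_add_right]
  rw [integral_add_right_eq_self (fun x => w x ^ 2) y,
    integral_add_right_eq_self (fun x => ‖∇ w x‖ ^ 2) y]

/-- Mollification does not increase the bound of the Laplacian in `H⁻¹`, when it is tested with
functions whose small translates remain supported in `Ω`. -/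
lemma abs_integral_convolution_mul_laplacian_le {M : ℝ} (φ : ContDiffBump (0 : Eu d))
    (hv : Continuous v) (hv0 : ∀ x, x ∉ Ω → v x = 0)
    (hM : ∀ w : Eu d → ℝ, IsTestFunction Ω w →
      |∫ x in Ω, v x * (Δ w) x| ≤ M * h1Norm Ω w (∇ w))
    (hw : IsTestFunction Ω w)
    (hwy : ∀ y : Eu d, ‖y‖ < φ.rOut → IsTestFunction Ω fun x => w (x + y)) :
    |∫ x in Ω, (∫ y, φ.normed volume y * v (x - y)) * (Δ w) x| ≤ M * h1Norm Ω w (∇ w) := by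
  have hswap : ∫ x, ∫ y, φ.normed volume y * v (x - y) * (Δ w) x =
      ∫ y, ∫ x, φ.normed volume y * v (x - y) * (Δ w) x := by
    refine integral_integral_swap_of_hasCompactSupport ?_ ?_
    · exact (((φ.continuous_normed.comp continuous_snd).mul
        (hv.comp (continuous_fst.sub continuous_snd))).mul
        (hw.smooth.continuous_laplacian.comp continuous_fst))
    · refine HasCompactSupport.intro (hw.compact.laplacian.prod (φ.hasCompactSupport_normed (μ := volume)))
        fun p hp => ?_
      rw [mem_prod, not_and_or] at hp
      rcases hp with hp | hp
      · simp [Function.uncurry, image_eq_zero_of_notMem_tsupport hp]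
      · simp [Function.uncurry, image_eq_zero_of_notMem_tsupport hp]
  -- After Fubini, the substitution `x ↦ x + y` moves the shift from `v` to `w`.
  have hleft : ∫ x in Ω, (∫ y, φ.normed volume y * v (x - y)) * (Δ w) x =
      ∫ y, φ.normed volume y * ∫ x, v x * (Δ w) (x + y) := by
    rw [setIntegral_eq_integral_of_forall_compl_eq_zero fun x hx => by
      rw [hw.laplacian_eq_zero_of_notMem hx, mul_zero]]
    simp_rw [← integral_mul_const]
    rw [hswap]
    refine integral_congr_ae (.of_forall fun y => ?_)
    dsimp only
    rw [← integral_const_mul, ← integral_add_right_eq_self _ y]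
    simp [mul_assoc]
  rw [hleft, ← Real.norm_eq_abs]
  have hpt (y : Eu d) : ‖φ.normed volume y * ∫ x, v x * (Δ w) (x + y)‖ ≤
      φ.normed volume y * (M * h1Norm Ω w (∇ w)) := by
    rw [norm_mul, Real.norm_of_nonneg (φ.nonneg_normed y)]
    by_cases hy : ‖y‖ < φ.rOut
    · refine mul_le_mul_of_nonneg_left ?_ (φ.nonneg_normed y)
      have h := hM _ (hwy y hy)
      rw [hw.h1Norm_comp_add_right (hwy y hy),
        setIntegral_eq_integral_of_forall_compl_eq_zero fun x hx => by
          rw [hv0 x hx, zero_mul]] at h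
      simpa only [laplacian_comp_add_right hw.smooth, Real.norm_eq_abs] using h
    · have : φ.normed volume y = 0 := by
        by_contra h0
        have : y ∈ Function.support (φ.normed volume) := h0
        rw [φ.support_normed_eq, mem_ball_zero_iff] at this
        exact hy this
      rw [this, zero_mul, zero_mul]
  refine (norm_integral_le_of_norm_le (φ.integrable_normed.mul_const _)
    (.of_forall hpt)).trans_eq ?_
  rw [integral_mul_const, φ.integral_normed, one_mul]

end Energy

/-! ### Functions vanishing at the boundary: part (a) -/

section VanishingAtBoundary

variable {d : ℕ} {Ω : Set (Eu d)} {v : Eu d → ℝ}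

namespace IsC0

/-- The extension by zero of a function in `C_0(Ω)` is continuous. -/
lemma continuous_indicator (hv : IsC0 Ω v) (hΩ : IsOpen Ω) : Continuous (Ω.indicator v) := by
  rw [continuous_iff_continuousAt]
  intro x
  by_cases hx : x ∈ Ω
  · refine (hv.continuousOn.continuousAt (hΩ.mem_nhds hx)).congr ?_
    filter_upwards [hΩ.mem_nhds hx] with y hy
    rw [indicator_of_mem hy]
  · rw [ContinuousAt, indicator_of_notMem hx]
    by_cases hx' : x ∈ closure Ω
    · have h := hv.tendsto_zero x ⟨hx', by rwa [hΩ.interior_eq]⟩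
      rw [Metric.tendsto_nhds] at h ⊢
      intro ε hε
      filter_upwards [eventually_nhdsWithin_iff.1 (h ε hε)] with y hy
      by_cases hyΩ : y ∈ Ω
      · rw [indicator_of_mem hyΩ]
        exact hy hyΩ
      · rw [indicator_of_notMem hyΩ, dist_self]
        exact hε
    · refine tendsto_const_nhds.congr' ?_
      filter_upwards [isClosed_closure.isOpen_compl.mem_nhds hx'] with y hy
      rw [indicator_of_notMem fun h => hy (subset_closure h)]

lemma hasCompactSupport_indicator (hΩ : Bornology.IsBounded Ω) (v : Eu d → ℝ) :
    HasCompactSupport (Ω.indicator v) :=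
  HasCompactSupport.intro hΩ.isCompact_closure fun _ hx =>
    indicator_of_notMem (fun h => hx (subset_closure h)) v

/-- A function in `C_0(Ω)` whose Laplacian belongs to `H⁻¹(Ω)` is uniformly approximated by
test functions bounded in `H¹(Ω)`. -/
lemma exists_testFunction_approx (hv : IsC0 Ω v) (hΩ : IsOpen Ω) (hΩb : Bornology.IsBounded Ω)
    {M : ℝ} (hM : ∀ w : Eu d → ℝ, IsTestFunction Ω w →
      |∫ x in Ω, v x * (Δ w) x| ≤ M * h1Norm Ω w (∇ w)) {η : ℝ} (hη : 0 < η) :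
    ∃ w : Eu d → ℝ, IsTestFunction Ω w ∧ (∀ x ∈ Ω, |w x - v x| ≤ 3 * η) ∧
      ∫ x in Ω, ‖∇ w x‖ ^ 2 ≤ M ^ 2 + ∫ x in Ω, w x ^ 2 := by
  set V : Eu d → ℝ := Ω.indicator v with hVdef
  have hV : Continuous V := hv.continuous_indicator hΩ
  have hVc : HasCompactSupport V := hasCompactSupport_indicator hΩb v
  have hV0 (x : Eu d) (hx : x ∉ Ω) : V x = 0 := indicator_of_notMem hx v
  have hVM (w : Eu d → ℝ) (hw : IsTestFunction Ω w) :
      |∫ x in Ω, V x * (Δ w) x| ≤ M * h1Norm Ω w (∇ w) := by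
    rw [setIntegral_congr_fun (g := fun x => v x * (Δ w) x) hΩ.measurableSet fun x hx => by
      simp only [hVdef, indicator_of_mem hx]]
    exact hM w hw
  -- If `f (u x) ≠ 0` then `|u x| > η`, and `u` is within `η / 2` of `V`; hence the threshold `η /
  -- 2`.
  let K : Set (Eu d) := {x | η / 2 ≤ |V x|}
  have hKΩ : K ⊆ Ω := fun x (hx : η / 2 ≤ |V x|) => by
    by_contra h
    rw [hV0 x h, abs_zero] at hx
    linarith
  have hKcl : IsClosed K := isClosed_le continuous_const hV.abs
  have hKc : IsCompact K :=
    hΩb.isCompact_closure.of_isClosed_subset hKcl (hKΩ.trans subset_closure)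
  obtain ⟨δ₁, hδ₁, hKδ⟩ := hKc.exists_thickening_subset_open hΩ hKΩ
  obtain ⟨δ₂, hδ₂, hVδ⟩ := Metric.uniformContinuous_iff.1
    (hVc.uniformContinuous_of_continuous hV) (η / 2) (by positivity)
  have hδ : 0 < min δ₁ δ₂ := lt_min hδ₁ hδ₂
  -- Radius `δ₁` keeps the translates of `K` inside `Ω`, and `δ₂` keeps the mollification within `η
  -- / 2` of `V`; the inner radius is immaterial.
  let φ : ContDiffBump (0 : Eu d) := ⟨min δ₁ δ₂ / 2, min δ₁ δ₂, by positivity, by linarith⟩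
  have hφ : φ.rOut = min δ₁ δ₂ := rfl
  set u : Eu d → ℝ := fun x => ∫ y, φ.normed volume y * V (x - y) with hudef
  have hu_conv : u = convolution (φ.normed volume) V (ContinuousLinearMap.lsmul ℝ ℝ) volume := rfl
  have hu : ContDiff ℝ ∞ u := by
    rw [hu_conv]
    exact φ.hasCompactSupport_normed.contDiff_convolution_left _ φ.contDiff_normed
      hV.locallyIntegrable
  have huc : HasCompactSupport u := by
    rw [hu_conv]
    exact φ.hasCompactSupport_normed.convolution _ hVc
  have huV (x : Eu d) : |u x - V x| ≤ η / 2 := by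
    rw [hu_conv]
    refine φ.dist_normed_convolution_le hV.aestronglyMeasurable fun y hy => (hVδ ?_).le
    exact (Metric.mem_ball.1 hy).trans_le (min_le_right _ _)
  obtain ⟨f, s, hf, hfs, hs0, hs1, hf0, hft⟩ := exists_smooth_truncation hη
  have hsupp : tsupport (fun x => f (u x)) ⊆ K := by
    refine closure_minimal (fun x hx => ?_) hKcl
    have h1 : η < |u x| := by
      by_contra! h
      exact hx (hf0 _ h)
    have h2 := abs_sub_abs_le_abs_sub (u x) (V x)
    have h3 := huV x
    change η / 2 ≤ |V x|
    linarith
  have hw : IsTestFunction Ω fun x => f (u x) :=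
    ⟨hf.comp hu, hKc.of_isClosed_subset (isClosed_tsupport _) hsupp, hsupp.trans hKΩ⟩
  refine ⟨fun x => f (u x), hw, fun x hx => ?_, ?_⟩
  · have h1 := hft (u x)
    have h2 := huV x
    rw [hVdef, indicator_of_mem hx] at h2
    have h3 := abs_sub_le (f (u x)) (u x) (v x)
    linarith
  · refine integral_gradient_truncation_sq_le hu huc hfs hs0 hs1 hw
      (abs_integral_convolution_mul_laplacian_le φ hV hV0 hVM hw fun y hy => ?_)
    refine hw.comp_add_right y fun x hx => hKδ ?_
    refine Metric.mem_thickening_iff.2 ⟨x + y, hsupp hx, ?_⟩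
    rw [dist_self_add_right]
    exact hy.trans_le (min_le_left _ _)

/-- A function in `C_0(Ω)` whose Laplacian belongs to `H⁻¹(Ω)` belongs to `H¹₀(Ω)`. -/
theorem memH10 (hv : IsC0 Ω v) (hΩ : IsOpen Ω) (hΩb : Bornology.IsBounded Ω)
    (hM : LaplacianMemHNegOne Ω v) : MemH10 Ω v := by
  obtain ⟨M, -, hM⟩ := hM
  have hV := hv.continuous_indicator hΩ
  have hVc := hasCompactSupport_indicator hΩb v
  obtain ⟨B, hB⟩ := hVc.exists_bound_of_continuous hV
  have hvB (x : Eu d) (hx : x ∈ Ω) : |v x| ≤ B := by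
    simpa [indicator_of_mem hx] using hB x
  have hvol : volume Ω < ⊤ := hΩb.measure_lt_top
  have hv2 : MemLp v 2 (volume.restrict Ω) := by
    have h := (hV.memLp_of_hasCompactSupport (p := 2) (μ := volume) hVc)
    exact (memLp_indicator_iff_restrict hΩ.measurableSet).1 h
  have hsq {w : Eu d → ℝ} {C : ℝ} (hw : ∀ x ∈ Ω, |w x| ≤ C) :
      ∫ x in Ω, w x ^ 2 ≤ C ^ 2 * volume.real Ω := by
    refine (Real.le_norm_self _).trans (norm_setIntegral_le_of_norm_le_const hvol fun x hx => ?_)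
    rw [norm_pow, Real.norm_eq_abs]
    exact pow_le_pow_left₀ (abs_nonneg _) (hw x hx) 2
  have hvol0 : 0 ≤ volume.real Ω := measureReal_nonneg
  -- The `L²` bound enters twice: in the norm itself and in the gradient estimate. The bound `B + 1`
  -- for `w` comes from `3 * η ≤ 1`.
  refine memH10_of_bounded_approx hv2 (√(M ^ 2 + 2 * ((B + 1) ^ 2 * volume.real Ω)))
    fun ε hε => ?_
  -- Adding `1` to the volume keeps the denominator positive and allows `volume.real Ω ≤
  -- (volume.real Ω + 1) ^ 2` below.
  set η : ℝ := min (1 / 3) (ε / (3 * (volume.real Ω + 1))) with hηdef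
  have hη : 0 < η := lt_min (by norm_num) (by positivity)
  have hη1 : 3 * η ≤ 1 := by
    have : η ≤ 1 / 3 := min_le_left _ _
    linarith
  have hη2 : 3 * η * (volume.real Ω + 1) ≤ ε := by
    have : η ≤ ε / (3 * (volume.real Ω + 1)) := min_le_right _ _
    rw [le_div_iff₀ (by positivity)] at this
    linarith
  obtain ⟨w, hw, hwv, hgrad⟩ := hv.exists_testFunction_approx hΩ hΩb hM hη
  refine ⟨w, hw, Real.sqrt_le_sqrt ?_, (hsq hwv).trans ?_⟩
  · have : ∫ x in Ω, w x ^ 2 ≤ (B + 1) ^ 2 * volume.real Ω := hsq fun x hx => by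
      have h1 := hwv x hx
      have h2 := hvB x hx
      have h3 := abs_sub_abs_le_abs_sub (w x) (v x)
      linarith
    linarith
  · calc (3 * η) ^ 2 * volume.real Ω ≤ (3 * η) ^ 2 * (volume.real Ω + 1) ^ 2 := by
          gcongr
          nlinarith
      _ = (3 * η * (volume.real Ω + 1)) ^ 2 := by ring
      _ ≤ ε ^ 2 := by gcongr

end IsC0

end VanishingAtBoundary

/-! ### Independence of the extension: part (b) -/

section Extension

variable {d : ℕ} {Ω : Set (Eu d)} {φ : frontier Ω → ℝ} {Φ Φ₁ Φ₂ u₁ u₂ : Eu d → ℝ}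

namespace IsAdmissibleExtension

lemma integrableOn_mul_laplacian (h : IsAdmissibleExtension Ω φ Φ) (hΩb : Bornology.IsBounded Ω)
    {w : Eu d → ℝ} (hw : IsTestFunction Ω w) :
    Integrable (fun x => Φ x * (Δ w) x) (volume.restrict Ω) :=
  ((h.continuousOn.mul hw.smooth.continuous_laplacian.continuousOn).integrableOn_compact
    hΩb.isCompact_closure).mono_set subset_closure

lemma integral_sub_mul_laplacian (h₁ : IsAdmissibleExtension Ω φ Φ₁)
    (h₂ : IsAdmissibleExtension Ω φ Φ₂) (hΩb : Bornology.IsBounded Ω)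
    {w : Eu d → ℝ} (hw : IsTestFunction Ω w) :
    ∫ x in Ω, (Φ₁ - Φ₂) x * (Δ w) x =
      (∫ x in Ω, Φ₁ x * (Δ w) x) - ∫ x in Ω, Φ₂ x * (Δ w) x := by
  rw [← integral_sub (h₁.integrableOn_mul_laplacian hΩb hw)
    (h₂.integrableOn_mul_laplacian hΩb hw)]
  simp [sub_mul]

lemma isC0_sub (h₁ : IsAdmissibleExtension Ω φ Φ₁) (h₂ : IsAdmissibleExtension Ω φ Φ₂) :
    IsC0 Ω (Φ₁ - Φ₂) := by
  have hc : ContinuousOn (Φ₁ - Φ₂) (closure Ω) := h₁.continuousOn.sub h₂.continuousOn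
  refine ⟨hc.mono subset_closure, fun z hz => ?_⟩
  have h := (hc z (frontier_subset_closure hz)).mono subset_closure
  have h0 : (Φ₁ - Φ₂) z = 0 := by
    rw [Pi.sub_apply, h₁.extends_boundary ⟨z, hz⟩, h₂.extends_boundary ⟨z, hz⟩, sub_self]
  rwa [ContinuousWithinAt, h0] at h

lemma laplacianMemHNegOne_sub (h₁ : IsAdmissibleExtension Ω φ Φ₁)
    (h₂ : IsAdmissibleExtension Ω φ Φ₂) (hΩb : Bornology.IsBounded Ω) :
    LaplacianMemHNegOne Ω (Φ₁ - Φ₂) := by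
  obtain ⟨M₁, hM₁0, hM₁⟩ := h₁.laplacian_mem
  obtain ⟨M₂, hM₂0, hM₂⟩ := h₂.laplacian_mem
  refine ⟨M₁ + M₂, add_nonneg hM₁0 hM₂0, fun w hw => ?_⟩
  rw [h₁.integral_sub_mul_laplacian h₂ hΩb hw, add_mul]
  exact (abs_sub _ _).trans (add_le_add (hM₁ w hw) (hM₂ w hw))

/-- The variational solution does not depend on the extension of the boundary values. -/
theorem eqOn_variationalSolution (h₁ : IsAdmissibleExtension Ω φ Φ₁)
    (h₂ : IsAdmissibleExtension Ω φ Φ₂) (hd : 0 < d) (hΩ : IsOpen Ω)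
    (hΩb : Bornology.IsBounded Ω) (hu₁ : IsVariationalSolutionFrom Ω Φ₁ u₁)
    (hu₂ : IsVariationalSolutionFrom Ω Φ₂ u₂) : EqOn u₁ u₂ Ω := by
  obtain ⟨harm₁, v₁, g₁, hv₁, hvar₁, hae₁⟩ := hu₁
  obtain ⟨harm₂, v₂, g₂, hv₂, hvar₂, hae₂⟩ := hu₂
  obtain ⟨g, hg⟩ := (h₁.isC0_sub h₂).memH10 hΩ hΩb (h₁.laplacianMemHNegOne_sub h₂ hΩb)
  have hg2 := hg.hasH1Gradient.memLp_gradient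
  have hg₁2 := hv₁.hasH1Gradient.memLp_gradient
  have hg₂2 := hv₂.hasH1Gradient.memLp_gradient
  -- Testing with `w`, the Laplacian of `Φ₁ - Φ₂` is expressed once through its own weak gradient
  -- `g` and once through `g₁ - g₂`, so `g - (g₁ - g₂)` is orthogonal to every `∇ w`.
  have hzero := (hg.sub (hv₁.sub hv₂)).ae_eq_zero hΩb hd fun w hw => by
    have hw2 := hw.memLp_gradient (volume.restrict Ω)
    have e := hg.hasH1Gradient.integral_mul_laplacian hw
    rw [h₁.integral_sub_mul_laplacian h₂ hΩb hw, hvar₁ w hw, hvar₂ w hw] at e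
    have i := integrable_inner_of_memLp hg2 hw2
    have i₁ := integrable_inner_of_memLp hg₁2 hw2
    have i₂ := integrable_inner_of_memLp hg₂2 hw2
    simp only [Pi.sub_apply, inner_sub_left]
    rw [integral_sub i (by exact i₁.sub i₂), integral_sub i₁ i₂]
    linarith
  -- Harmonic functions are continuous, so equality almost everywhere on the open set `Ω` is
  -- equality everywhere on it.
  refine Measure.eqOn_open_of_ae_eq (μ := volume) ?_ hΩ harm₁.contDiffOn.continuousOn
    harm₂.contDiffOn.continuousOn
  filter_upwards [hzero, hae₁, hae₂] with x h0 e₁ e₂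
  simp only [Pi.sub_apply, Pi.zero_apply] at h0
  linarith

end IsAdmissibleExtension

end Extension

theorem lemma2p2 {d : ℕ} (hd : 2 ≤ d) (Ω : Set (Eu d)) (hΩ_open : IsOpen Ω)
    (hΩ_conn : IsConnected Ω) (hΩ_bdd : Bornology.IsBounded Ω) :
    (∀ v : Eu d → ℝ, IsC0 Ω v → LaplacianMemHNegOne Ω v → MemH10 Ω v) ∧
    (∀ φ : frontier Ω → ℝ, Continuous φ →
      ∀ Φ₁ Φ₂ u₁ u₂ : Eu d → ℝ,
        IsAdmissibleExtension Ω φ Φ₁ → IsAdmissibleExtension Ω φ Φ₂ →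
        IsVariationalSolutionFrom Ω Φ₁ u₁ → IsVariationalSolutionFrom Ω Φ₂ u₂ →
        EqOn u₁ u₂ Ω) :=
  ⟨fun _ hv hΔ => hv.memH10 hΩ_open hΩ_bdd hΔ, fun _ _ _ _ _ _ h₁ h₂ hu₁ hu₂ =>
    h₁.eqOn_variationalSolution h₂ (by omega) hΩ_open hΩ_bdd hu₁ hu₂⟩
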